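/- Let $p$ be an odd prime with $3\mid (p-1)$ and put $n=3p$. For $x=(x_0,\dots,x_{n-1})\in\mathbb{F}_p^{n}$ take subscripts modulo $n$, and let the symbol-pair distance of $x,y\in\mathbb{F}_p^n$ be the number of $i\in\mathbb{Z}/n\mathbb{Z}$ with $(x_i,x_{i+1})\neq(y_i,y_{i+1})$. The minimum symbol-pair distance of a code $\mathcal{C}\subseteq\mathbb{F}_p^n$ is the minimum of the symbol-pair distances of its pairs of distinct codewords. A code $\mathcal{C}\subseteq\mathbb{F}_p^n$ with minimum symbol-pair distance $d$, $2\le d\le n$, is called an MDS $(n,d)_p$ symbol-pair code if it attains the Singleton bound, that is, $|\mathcal{C}|=p^{\,n-d+2}$. Then there exists an MDS $(3p,12)_p$ symbol-pair code. More precisely, let $\omega$ be any primitive cube root of unity in $\mathbb{F}_p$ and let $$g(x)=(x-1)^5(x-\omega)^3(x-\omega^2)^2 .$$ Then $g$ divides $x^{3p}-1$, and the repeated-root cyclic code $\mathcal{C}$ of length $3p$ over $\mathbb{F}_p$ with generator polynomial $g$, that is, the set of words $(c_0,\dots,c_{3p-1})$ for which $c_0+c_1x+\cdots+c_{3p-1}x^{3p-1}$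 lies in the ideal generated by $g$ in $\mathbb{F}_p[x]/(x^{3p}-1)$, is a $[3p,\,3p-10,\,6]$ code (dimension $3p-10$ and minimum Hamming distance $6$) with minimum symbol-pair distance $12$. In particular $\mathcal{C}$ is an MDS $(3p,12)_p$ symbol-pair code. -/

import Mathlib

open Polynomial

noncomputable section

namespace SymbolPair

/-- The symbol-pair read vector `π(x) = ((x₀, x₁), (x₁, x₂), …, (xₙ₋₁, x₀))` of a word `x` of
length `n`; coordinates are indexed by `ℤ/nℤ`. -/
def readVector {n : ℕ} {F : Type*} (x : ZMod n → F) : ZMod n → F × F :=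
  fun i => (x i, x (i + 1))

/-- The symbol-pair distance: the number of `i` with `(xᵢ, xᵢ₊₁) ≠ (yᵢ, yᵢ₊₁)`. -/
def pairDist {n : ℕ} [NeZero n] {F : Type*} [DecidableEq F] (x y : ZMod n → F) : ℕ :=
  hammingDist (readVector x) (readVector y)

/-- `d` is the minimum Hamming distance of the code `C`. -/
def IsMinHammingDist {n : ℕ} [NeZero n] {F : Type*} [DecidableEq F]
    (C : Set (ZMod n → F)) (d : ℕ) : Prop :=
  IsLeast {e : ℕ | ∃ x ∈ C, ∃ y ∈ C, x ≠ y ∧ e = hammingDist x y} d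

/-- `d` is the minimum symbol-pair distance of the code `C`. -/
def IsMinPairDist {n : ℕ} [NeZero n] {F : Type*} [DecidableEq F]
    (C : Set (ZMod n → F)) (d : ℕ) : Prop :=
  IsLeast {e : ℕ | ∃ x ∈ C, ∃ y ∈ C, x ≠ y ∧ e = pairDist x y} d

/-- `C` is an MDS `(n, d)_q` symbol-pair code, `q = |F|`: its minimum symbol-pair distance is `d`
and it attains the Singleton bound `|C| ≤ q ^ (n - d + 2)`, where `2 ≤ d ≤ n`. -/
def IsMDSPairCode {n : ℕ} [NeZero n] {F : Type*} [DecidableEq F]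
    (C : Set (ZMod n → F)) (d : ℕ) : Prop :=
  2 ≤ d ∧ d ≤ n ∧ IsMinPairDist C d ∧ C.ncard = Nat.card F ^ (n - d + 2)

/-- The linear code `C` (of length `n`) is an `[n, k, d]` code. -/
def IsLinearCodeWith {n : ℕ} [NeZero n] {F : Type*} [Field F] [DecidableEq F]
    (C : Submodule F (ZMod n → F)) (k d : ℕ) : Prop :=
  Module.finrank F C = k ∧ IsMinHammingDist (C : Set (ZMod n → F)) d

/-- A linear code is cyclic if it is closed under
`(x₀, x₁, …, xₙ₋₁) ↦ (xₙ₋₁, x₀, …, xₙ₋₂)`. -/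
def IsCyclicCode {n : ℕ} {F : Type*} [Field F] (C : Submodule F (ZMod n → F)) : Prop :=
  ∀ c ∈ C, (fun i => c (i - 1)) ∈ C

/-- A cyclic code of length `n` is repeated-root if the characteristic of the field divides `n`. -/
def IsRepeatedRootCyclicCode {n : ℕ} {F : Type*} [Field F]
    (C : Submodule F (ZMod n → F)) : Prop :=
  IsCyclicCode C ∧ ringChar F ∣ n

/-- The polynomial `c₀ + c₁ X + ⋯ + cₙ₋₁ Xⁿ⁻¹` of a word `c`. -/
def wordPoly {n : ℕ} {F : Type*} [Field F] (c : ZMod n → F) : F[X] :=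
  ∑ i ∈ Finset.range n, C (c (i : ZMod n)) * X ^ i

/-- The code `⟨g⟩` of length `n`: the words `c` with
`c(X) = f(X) g(X)` in `F[X] / (Xⁿ - 1)` for some polynomial `f`. -/
def cyclicCode (n : ℕ) {F : Type*} [Field F] (g : F[X]) : Submodule F (ZMod n → F) where
  carrier := {c | ∃ f : F[X], (X ^ n - 1 : F[X]) ∣ wordPoly c - f * g}
  zero_mem' := ⟨0, by simp [wordPoly]⟩
  add_mem' := by
    rintro a b ⟨f, hf⟩ ⟨h, hh⟩
    refine ⟨f + h, ?_⟩
    have : wordPoly (a + b) - (f + h) * g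
        = (wordPoly a - f * g) + (wordPoly b - h * g) := by
      simp only [wordPoly, Pi.add_apply, C_add, add_mul, Finset.sum_add_distrib]
      ring
    rw [this]
    exact dvd_add hf hh
  smul_mem' := by
    rintro r a ⟨f, hf⟩
    refine ⟨C r * f, ?_⟩
    have : wordPoly (r • a) - C r * f * g = C r * (wordPoly a - f * g) := by
      simp only [wordPoly, Pi.smul_apply, smul_eq_mul, C_mul, mul_sub, Finset.mul_sum, mul_assoc]
    rw [this]
    exact dvd_mul_of_dvd_right hf _

/-- `g` is the generator polynomial of the code `D` of length `n`: `g` is monic, divides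
`Xⁿ - 1`, and `D = ⟨g⟩`. -/
def IsGeneratorPoly {n : ℕ} {F : Type*} [Field F] (D : Submodule F (ZMod n → F))
    (g : F[X]) : Prop :=
  g.Monic ∧ g ∣ X ^ n - 1 ∧ D = cyclicCode n g

end SymbolPair

end

/-!
The positions `ℤ/3pℤ` are identified with `ℤ/3ℤ × 𝔽_p`, and the code is studied through the power
moments `∑ cᵢ iᵏ` over the residue classes modulo `3`. If `g` divides the polynomial of `c`, the
roots `1, ω, ω²` of multiplicities `5, 3, 2` give (`MomentConditions.of_dvd`): in each class `s`
the moments of order `0` and `1` vanish, those of order `2` are `λ ωˢ` for one scalar `λ`, and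
those of order `3` and of order `4` sum to zero over the three classes. By Vandermonde, a nonempty
class whose first `m` moments vanish contains more than `m` positions of the support.

The pair weight of a word with support `S` is `|S|` plus the number of runs of `S`, and also `2|S|`
minus the number of adjacent pairs in `S`. It is at least `12` for a nonzero codeword:

* If `λ = 0`, nonempty classes have at least four elements, six if there is only one. If some
  class is empty, runs have length at most two, and counting adjacent pairs gives `12`
  (`MomentConditions.twelve_le_pairWeight`).
* If `λ ≠ 0`, each class has at least three elements, so `|S| ≥ 9`, and a pair weight below `12`
  leaves two possibilities. Either `S` lies in ten consecutive positions, which is impossible since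
  `g` has degree `10` (`eq_zero_of_mem_of_run`); or `S` consists of two runs of total length nine.
  In the latter case each class consists of three nodes `x, y, z`, and its moments of order
  `2, 3, 4` are in the ratio `1 : h₁(x, y, z) : h₂(x, y, z)` of complete symmetric polynomials. The
  conditions of order `3` and `4` then are two equations for `ω` and the offset between the runs,
  which are incompatible in characteristic greater than `5` (`MomentConditions.false_of_two_runs`).

As the pair weight is at most twice the Hamming weight, every nonzero codeword has Hamming weight at
least `6`. The codeword `(X³ - 1)⁵` has weight at most `6`, hence attains both bounds.
-/

namespace SymbolPair

/-! ### Words, polynomials and cyclic codes -/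

section Words

variable {n : ℕ} {F : Type*} [Field F]

theorem coeff_wordPoly (c : ZMod n → F) (j : ℕ) :
    (wordPoly c).coeff j = if j < n then c j else 0 := by
  simp [wordPoly, Polynomial.finsetSum_coeff, coeff_C_mul, coeff_X_pow]

theorem degree_wordPoly_lt (c : ZMod n → F) : (wordPoly c).degree < n := by
  rw [degree_lt_iff_coeff_zero]
  intro m hm
  rw [coeff_wordPoly, if_neg (by omega)]

theorem mem_cyclicCode_iff {g : F[X]} (hg : g ∣ X ^ n - 1) {c : ZMod n → F} :
    c ∈ cyclicCode n g ↔ g ∣ wordPoly c := by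
  constructor
  · rintro ⟨f, hf⟩
    have h := dvd_add (hg.trans hf) (dvd_mul_left g f)
    rwa [sub_add_cancel] at h
  · rintro ⟨f, hf⟩
    exact ⟨f, by rw [hf, mul_comm g f, sub_self]; exact dvd_zero _⟩

theorem wordPoly_coeff_eq {f : F[X]} (hf : f.degree < n) :
    wordPoly (fun i : ZMod n => f.coeff i.val) = f := by
  ext j
  rw [coeff_wordPoly]
  split_ifs with h
  · rw [ZMod.val_natCast_of_lt h]
  · exact (coeff_eq_zero_of_degree_lt (hf.trans_le (by exact_mod_cast not_lt.mp h))).symm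

variable [NeZero n]

theorem coeff_wordPoly_val (c : ZMod n → F) (i : ZMod n) :
    (wordPoly c).coeff i.val = c i := by
  rw [coeff_wordPoly, if_pos i.val_lt, ZMod.natCast_zmod_val]

theorem X_pow_sub_one_dvd_wordPoly_shift (c : ZMod n → F) :
    (X ^ n - 1 : F[X]) ∣ wordPoly (fun i => c (i - 1)) - X * wordPoly c := by
  obtain ⟨m, rfl⟩ : ∃ m, n = m + 1 := ⟨n - 1, by have := NeZero.pos n; omega⟩
  have h0 : ((0 : ℕ) : ZMod (m + 1)) - 1 = (m : ZMod (m + 1)) := by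
    have := ZMod.natCast_self (m + 1)
    push_cast at this ⊢
    linear_combination -this
  refine ⟨-C (c m), ?_⟩
  simp only [wordPoly]
  rw [Finset.sum_range_succ', Finset.sum_range_succ (fun i => C (c (i : ZMod (m + 1))) * X ^ i),
    h0, mul_add, Finset.mul_sum]
  have : ∀ i ∈ Finset.range m, C (c (((i + 1 : ℕ) : ZMod (m + 1)) - 1)) * X ^ (i + 1)
      = X * (C (c (i : ZMod (m + 1))) * X ^ i) := by
    intro i _
    rw [Nat.cast_succ, add_sub_cancel_right]
    ring
  rw [Finset.sum_congr rfl this]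
  ring

theorem isCyclicCode_cyclicCode (g : F[X]) : IsCyclicCode (cyclicCode n g) := by
  rintro c ⟨f, hf⟩
  refine ⟨X * f, ?_⟩
  have h := dvd_add (X_pow_sub_one_dvd_wordPoly_shift c) (dvd_mul_of_dvd_right hf X)
  convert h using 1
  ring

theorem IsCyclicCode.translate_mem {D : Submodule F (ZMod n → F)} (hD : IsCyclicCode D)
    {c : ZMod n → F} (hc : c ∈ D) (j : ZMod n) : (fun i => c (i + j)) ∈ D := by
  have key : ∀ k : ℕ, (fun i => c (i - k)) ∈ D := by
    intro k
    induction k with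
    | zero => simpa using hc
    | succ k ih =>
      convert hD _ ih using 2 with i
      push_cast
      congr 1
      ring
  simpa using key (-j).val

theorem finrank_cyclicCode {g : F[X]} (hm : g.Monic) (hg : g ∣ X ^ n - 1) :
    Module.finrank F (cyclicCode n g) = n - g.natDegree := by
  have hn : g.natDegree ≤ n := by
    have h := natDegree_le_of_dvd hg (X_pow_sub_C_ne_zero (NeZero.pos n) (1 : F))
    rwa [← C_1, natDegree_X_pow_sub_C] at h
  have hdeg : ∀ q : F[X], (q * g).degree < n ↔ q.degree < (n - g.natDegree : ℕ) := by
    intro q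
    rcases eq_or_ne q 0 with rfl | hq
    · simp
    · rw [degree_mul, degree_eq_natDegree hq, degree_eq_natDegree hm.ne_zero]
      norm_cast
      omega
  let φ : degreeLT F (n - g.natDegree) →ₗ[F] (ZMod n → F) :=
    { toFun := fun q i => (q.1 * g).coeff i.val
      map_add' := by intro a b; ext i; simp [add_mul]
      map_smul' := by intro a b; ext i; simp }
  have hw : ∀ q, wordPoly (φ q) = q.1 * g := fun q =>
    wordPoly_coeff_eq ((hdeg _).2 (mem_degreeLT.1 q.2))
  have hinj : Function.Injective φ := by
    intro a b hab
    have h := hw a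
    rw [hab, hw b] at h
    exact Subtype.ext (mul_right_cancel₀ hm.ne_zero h.symm)
  have hrange : LinearMap.range φ = cyclicCode n g := by
    ext c
    rw [mem_cyclicCode_iff hg, LinearMap.mem_range]
    constructor
    · rintro ⟨q, rfl⟩
      rw [hw]
      exact dvd_mul_left _ _
    · rintro ⟨q, hq⟩
      rw [mul_comm] at hq
      refine ⟨⟨q, mem_degreeLT.2 ((hdeg q).1 (hq ▸ degree_wordPoly_lt c))⟩, ?_⟩
      ext i
      change (q * g).coeff i.val = c i
      rw [← hq, coeff_wordPoly_val]
  rw [← hrange, LinearMap.finrank_range_of_inj hinj, (degreeLTEquiv F _).finrank_eq,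
    Module.finrank_fin_fun]

end Words

/-! ### Vanishing power moments -/

/-- The operator `X d/dX` turns `∑ aᵢ Xⁱ` into `∑ i aᵢ Xⁱ` and lowers the multiplicity of a root
by at most one; iterating it, a root `r` of multiplicity `m` gives `m` vanishing moments. -/
theorem sum_mul_pow_eq_zero_of_pow_dvd {F : Type*} [Field F] (n : ℕ) (r : F) (k : ℕ) :
    ∀ (m : ℕ) (a : ℕ → F), k < m → (X - C r) ^ m ∣ ∑ i ∈ Finset.range n, C (a i) * X ^ i →
      ∑ i ∈ Finset.range n, a i * (i : F) ^ k * r ^ i = 0 := by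
  induction k with
  | zero =>
    intro m a hm h
    have h1 : eval r (∑ i ∈ Finset.range n, C (a i) * X ^ i) = 0 :=
      dvd_iff_isRoot.1 ((dvd_pow_self _ (by omega)).trans h)
    simpa [eval_finsetSum] using h1
  | succ k ih =>
    intro m a hm h
    have h1 := dvd_mul_of_dvd_right (pow_sub_one_dvd_derivative_of_pow_dvd h) X
    have h2 := ih (m - 1) (fun i => a i * i) (by omega) (by
      convert h1 using 1
      rw [derivative_sum, Finset.mul_sum]
      refine Finset.sum_congr rfl fun i _ => ?_
      rw [derivative_C_mul_X_pow]
      rcases i with _ | i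
      · simp
      · simp only [Nat.add_sub_cancel]
        ring)
    rw [← h2]
    exact Finset.sum_congr rfl fun i _ => by ring

theorem sum_zmod_eq_zero_of_pow_dvd_wordPoly {n : ℕ} [NeZero n] {F : Type*} [Field F]
    (c : ZMod n → F) {r : F} {m : ℕ} (h : (X - C r) ^ m ∣ wordPoly c) {k : ℕ} (hk : k < m) :
    ∑ i : ZMod n, c i * (i.val : F) ^ k * r ^ i.val = 0 := by
  rw [← sum_mul_pow_eq_zero_of_pow_dvd n r k m (fun i => c i) hk h]
  refine Finset.sum_nbij' ZMod.val (fun i : ℕ => (i : ZMod n)) ?_ ?_ ?_ ?_ ?_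
  · intro i _; simpa using i.val_lt
  · intro i _; simp
  · intro i _; simp
  · intro i hi; exact ZMod.val_natCast_of_lt (Finset.mem_range.1 hi)
  · intro i _; simp

/-- Vandermonde: if the weights `c` on a set `A` are nonzero and the nodes `v` are distinct, then
fewer than `A.card` of the moments `∑ c v⁰, ∑ c v¹, …` can vanish in succession. -/
theorem lt_card_of_sum_mul_pow_eq_zero {ι F : Type*} [Field F]
    {A : Finset ι} {c v : ι → F} (hv : Set.InjOn v A) (hc : ∀ i ∈ A, c i ≠ 0) {m : ℕ}
    (hne : A.Nonempty) (h : ∀ k < m, ∑ i ∈ A, c i * v i ^ k = 0) : m < A.card := by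
  classical
  by_contra! hm
  obtain ⟨i₀, hi₀⟩ := hne
  set q : F[X] := ∏ i ∈ A.erase i₀, (X - C (v i)) with hq
  have hdeg : q.natDegree < m := by
    rw [hq, natDegree_prod_of_monic _ _ fun i _ => monic_X_sub_C _]
    simp only [natDegree_X_sub_C, Finset.sum_const, smul_eq_mul, mul_one]
    rw [Finset.card_erase_of_mem hi₀]
    have := Finset.card_pos.2 ⟨i₀, hi₀⟩
    omega
  have h1 : ∑ i ∈ A, c i * q.eval (v i) = 0 := by
    simp only [eval_eq_sum_range' hdeg, Finset.mul_sum]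
    rw [Finset.sum_comm]
    refine Finset.sum_eq_zero fun k hk => ?_
    have := h k (Finset.mem_range.1 hk)
    calc _ = q.coeff k * ∑ i ∈ A, c i * v i ^ k := by
            rw [Finset.mul_sum]
            exact Finset.sum_congr rfl fun i _ => by ring
      _ = 0 := by rw [this, mul_zero]
  rw [Finset.sum_eq_single_of_mem i₀ hi₀] at h1
  · rcases mul_eq_zero.1 h1 with h1 | h1
    · exact hc _ hi₀ h1
    · rw [hq, eval_prod, Finset.prod_eq_zero_iff] at h1
      obtain ⟨i, hi, h1⟩ := h1
      rw [eval_sub, eval_X, eval_C, sub_eq_zero] at h1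
      exact (Finset.ne_of_mem_erase hi)
        (hv (Finset.mem_of_mem_erase hi) hi₀ h1.symm)
  · intro i hi hne
    rw [hq, eval_prod, Finset.prod_eq_zero (Finset.mem_erase.2 ⟨hne, hi⟩) (by simp), mul_zero]

/-! ### Pair weight and runs -/

section PairWeight

variable {n : ℕ} [NeZero n] {F : Type*} [Field F] [DecidableEq F]

/-- The support of a word. -/
def wordSupport (c : ZMod n → F) : Finset (ZMod n) := {i | c i ≠ 0}

/-- The symbol-pair weight of a word: its symbol-pair distance to the zero word. -/
def pairWeight (c : ZMod n → F) : ℕ :=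
  (Finset.univ.filter fun i => c i ≠ 0 ∨ c (i + 1) ≠ 0).card

/-- The cyclic gaps of `S`: the positions outside `S` immediately before a run of `S`. -/
def gaps (S : Finset (ZMod n)) : Finset (ZMod n) := {i | i ∉ S ∧ i + 1 ∈ S}

@[simp] theorem mem_wordSupport {c : ZMod n → F} {i : ZMod n} : i ∈ wordSupport c ↔ c i ≠ 0 := by
  simp [wordSupport]

theorem hammingDist_eq_card_wordSupport_sub (x y : ZMod n → F) :
    hammingDist x y = (wordSupport (x - y)).card := by
  simp [hammingDist, wordSupport, sub_ne_zero]

theorem pairDist_eq_pairWeight_sub (x y : ZMod n → F) : pairDist x y = pairWeight (x - y) := by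
  unfold pairDist hammingDist pairWeight readVector
  congr 1
  ext i
  simp only [Finset.mem_filter, Finset.mem_univ, true_and, ne_eq, Prod.mk.injEq, Pi.sub_apply,
    sub_eq_zero]
  tauto

theorem card_filter_add_one_mem (S : Finset (ZMod n)) :
    (Finset.univ.filter fun i => i + 1 ∈ S).card = S.card := by
  refine Finset.card_nbij' (· + 1) (· - 1) ?_ ?_ ?_ ?_ <;> intro i <;> simp

theorem pairWeight_eq_card_union (c : ZMod n → F) :
    pairWeight c
      = (wordSupport c ∪ Finset.univ.filter fun i => i + 1 ∈ wordSupport c).card := by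
  unfold pairWeight
  congr 1
  ext i
  simp

theorem pairWeight_add_card_inter (c : ZMod n → F) :
    pairWeight c + ((wordSupport c).filter fun i => i + 1 ∈ wordSupport c).card
      = 2 * (wordSupport c).card := by
  have h := Finset.card_union_add_card_inter (wordSupport c)
    (Finset.univ.filter fun i => i + 1 ∈ wordSupport c)
  rw [card_filter_add_one_mem] at h
  rw [pairWeight_eq_card_union, two_mul, ← h]
  congr 2
  ext i
  simp

theorem pairWeight_eq_card_add_card_gaps (c : ZMod n → F) :
    pairWeight c = (wordSupport c).card + (gaps (wordSupport c)).card := by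
  rw [pairWeight_eq_card_union, ← Finset.card_union_of_disjoint]
  · congr 1
    ext i
    simp only [Finset.mem_union, gaps, Finset.mem_filter, Finset.mem_univ, true_and]
    tauto
  · rw [Finset.disjoint_left]
    intro i hi h
    simp only [gaps, Finset.mem_filter] at h
    exact h.2.1 hi

theorem pairWeight_translate (c : ZMod n → F) (j : ZMod n) :
    pairWeight (fun i => c (i + j)) = pairWeight c := by
  unfold pairWeight
  refine Finset.card_nbij' (· + j) (· - j) ?_ ?_ ?_ ?_ <;> intro i <;>
    simp [add_right_comm]

end PairWeight

/-- A proper subset `S` of `ℤ/nℤ` is the union of its runs: each element is `g + d` for a gap `g`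
and `1 ≤ d ≤ ℓ g`, where the run lengths `ℓ g` add up to the size of `S`. -/
theorem exists_run_lengths {n : ℕ} [NeZero n] {S : Finset (ZMod n)} (hS : S ≠ Finset.univ) :
    ∃ ℓ : ZMod n → ℕ, (∀ x ∈ S, ∃ g ∈ gaps S, ∃ d, 1 ≤ d ∧ d ≤ ℓ g ∧ x = g + d) ∧
      ∑ g ∈ gaps S, ℓ g = S.card := by
  classical
  obtain ⟨y, hy⟩ : ∃ y, y ∉ S := by
    by_contra! h
    exact hS (Finset.eq_univ_iff_forall.2 h)
  have hex : ∀ x : ZMod n, ∃ d : ℕ, x - d ∉ S := fun x => ⟨(x - y).val, by simpa using hy⟩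
  -- `back x` is the number of steps back from `x` to the nearest position outside `S`.
  let back : ZMod n → ℕ := fun x => Nat.find (hex x)
  have hback : ∀ x, x - (back x : ZMod n) ∉ S := fun x => Nat.find_spec (hex x)
  have hmin : ∀ x, ∀ d < back x, x - (d : ZMod n) ∈ S := fun x d hd =>
    not_not.1 (Nat.find_min (hex x) hd)
  have hpos : ∀ x ∈ S, 1 ≤ back x := by
    intro x hx
    by_contra! h
    have := hback x
    rw [Nat.lt_one_iff.1 h] at this
    simp [hx] at this
  have hgap : ∀ x ∈ S, x - (back x : ZMod n) ∈ gaps S := by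
    intro x hx
    have h1 := hmin x (back x - 1) (by have := hpos x hx; omega)
    rw [Nat.cast_sub (hpos x hx)] at h1
    simp only [gaps, Finset.mem_filter, Finset.mem_univ, true_and]
    exact ⟨hback x, by convert h1 using 1; push_cast; ring⟩
  refine ⟨fun g => (S.filter fun x => x - (back x : ZMod n) = g).card, ?_, ?_⟩
  · intro x hx
    refine ⟨_, hgap x hx, back x, hpos x hx, ?_, by ring⟩
    set g := x - (back x : ZMod n) with hg
    have hval : ∀ j ≤ back x, back (g + j) = j := by
      intro j hj
      refine (Nat.find_eq_iff _).2 ⟨by simpa using hback x, fun i hi => not_not.2 ?_⟩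
      have := hmin x (back x - j + i) (by omega)
      rw [Nat.cast_add, Nat.cast_sub hj] at this
      convert this using 1
      rw [hg]; ring
    have hcard : (Finset.Icc 1 (back x)).card = back x := by simp
    calc back x = (Finset.Icc 1 (back x)).card := hcard.symm
      _ ≤ _ := ?_
    refine Finset.card_le_card_of_injOn (fun j : ℕ => g + j) ?_ ?_
    · intro j hj
      rw [Finset.coe_Icc, Set.mem_Icc] at hj
      have hv := hval j hj.2
      rw [Finset.mem_coe, Finset.mem_filter]
      refine ⟨?_, by rw [hv]; ring⟩
      have := hmin (g + j) 0 (by omega)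
      simpa using this
    · intro j hj j' hj' h
      rw [Finset.coe_Icc, Set.mem_Icc] at hj hj'
      have := congrArg back h
      simp only at this
      rwa [hval j hj.2, hval j' hj'.2] at this
  · exact (Finset.card_eq_sum_card_fiberwise hgap).symm

/-! ### Words of length `3p` and their class moments -/

section Classes

variable {p : ℕ} [Fact p.Prime]

/-- The residue class modulo `3` of a position in `ℤ/3pℤ`. -/
def residue (p : ℕ) : ZMod (3 * p) →+* ZMod 3 := ZMod.castHom (dvd_mul_right 3 p) _

/-- A position in `ℤ/3pℤ` read modulo `p`, as an element of `𝔽_p`. -/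
def node (p : ℕ) : ZMod (3 * p) →+* ZMod p := ZMod.castHom (dvd_mul_left p 3) _

/-- The `k`-th power moment `∑ cᵢ iᵏ` of a word, taken over the positions `i ≡ s (mod 3)`. -/
def moment (c : ZMod (3 * p) → ZMod p) (s : ZMod 3) (k : ℕ) : ZMod p :=
  ∑ i with residue p i = s, c i * node p i ^ k

/-- The part of the support of a word in the residue class `s` modulo `3`. -/
def classSupport (c : ZMod (3 * p) → ZMod p) (s : ZMod 3) : Finset (ZMod (3 * p)) :=
  (wordSupport c).filter fun i => residue p i = s

/-- The generator polynomial `(X - 1)⁵ (X - ω)³ (X - ω²)²`. -/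
noncomputable abbrev genPoly (ω : ZMod p) : (ZMod p)[X] :=
  (X - C 1) ^ 5 * (X - C ω) ^ 3 * (X - C (ω ^ 2)) ^ 2

theorem val_residue (i : ZMod (3 * p)) : (residue p i).val = i.val % 3 := by
  rw [residue, ZMod.castHom_apply, ← ZMod.natCast_val, ZMod.val_natCast]

theorem natCast_val_eq_node (i : ZMod (3 * p)) : (i.val : ZMod p) = node p i := by
  rw [node, ZMod.castHom_apply, ZMod.natCast_val]

theorem eq_of_residue_eq_of_node_eq (h3 : p ≠ 3) {i j : ZMod (3 * p)}
    (hr : residue p i = residue p j) (hv : node p i = node p j) : i = j := by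
  have hcop : Nat.Coprime 3 p :=
    (Nat.coprime_primes Nat.prime_three Fact.out).2 h3.symm
  rw [← sub_eq_zero, ← map_sub] at hr hv
  rw [← sub_eq_zero]
  set d := i - j
  have h1 : 3 ∣ d.val := by
    have := val_residue d
    rw [hr, ZMod.val_zero] at this
    omega
  have h2 : p ∣ d.val := by
    rw [← ZMod.natCast_eq_zero_iff, natCast_val_eq_node, hv]
  have h := hcop.mul_dvd_of_dvd_of_dvd h1 h2
  rwa [← ZMod.natCast_eq_zero_iff, ZMod.natCast_zmod_val] at h

theorem sum_zmod_three {M : Type*} [AddCommMonoid M] (f : ZMod 3 → M) :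
    ∑ s, f s = f 0 + f 1 + f 2 := Fin.sum_univ_three f

theorem sum_zmod_three_shift (s : ZMod 3) (f : ZMod 3 → ℕ) :
    ∑ t, f t = f s + f (s + 1) + f (s + 2) := by
  rw [← Equiv.sum_comp (Equiv.addLeft s) f, sum_zmod_three]
  simp

theorem card_wordSupport_eq_sum (c : ZMod (3 * p) → ZMod p) :
    (wordSupport c).card = ∑ s, (classSupport c s).card :=
  Finset.card_eq_sum_card_fiberwise fun _ _ => Finset.mem_coe.2 (Finset.mem_univ _)

theorem moment_eq_sum_classSupport (c : ZMod (3 * p) → ZMod p) (s : ZMod 3) (k : ℕ) :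
    moment c s k = ∑ i ∈ classSupport c s, c i * node p i ^ k := by
  unfold moment
  symm
  refine Finset.sum_subset ?_ ?_
  · intro i
    simp [classSupport]
  · intro i hi h
    have : c i = 0 := by simpa [classSupport, (Finset.mem_filter.1 hi).2] using h
    rw [this, zero_mul]

theorem lt_card_classSupport (h3 : p ≠ 3) {c : ZMod (3 * p) → ZMod p} {s : ZMod 3} {m : ℕ}
    (hne : (classSupport c s).Nonempty) (h : ∀ k < m, moment c s k = 0) :
    m < (classSupport c s).card := by
  refine lt_card_of_sum_mul_pow_eq_zero (c := c) (v := node p) ?_ ?_ hne ?_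
  · intro i hi j hj hij
    refine eq_of_residue_eq_of_node_eq h3 ?_ hij
    rw [(Finset.mem_filter.1 hi).2, (Finset.mem_filter.1 hj).2]
  · intro i hi
    exact mem_wordSupport.1 (Finset.mem_filter.1 hi).1
  · intro k hk
    rw [← moment_eq_sum_classSupport, h k hk]

theorem sum_mul_pow_val_eq_moments (c : ZMod (3 * p) → ZMod p) {r : ZMod p} (hr : r ^ 3 = 1)
    (k : ℕ) :
    ∑ i, c i * (i.val : ZMod p) ^ k * r ^ i.val
      = moment c 0 k + r * moment c 1 k + r ^ 2 * moment c 2 k := by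
  have h1 : ∀ i : ZMod (3 * p), c i * (i.val : ZMod p) ^ k * r ^ i.val
      = r ^ (residue p i).val * (c i * node p i ^ k) := by
    intro i
    rw [val_residue, ← pow_eq_pow_mod _ hr, natCast_val_eq_node]
    ring
  rw [Finset.sum_congr rfl fun i _ => h1 i, ← Finset.sum_fiberwise _ (residue p)]
  have h2 : ∀ s : ZMod 3, ∑ i with residue p i = s,
      r ^ (residue p i).val * (c i * node p i ^ k) = r ^ s.val * moment c s k := by
    intro s
    rw [moment, Finset.mul_sum]
    exact Finset.sum_congr rfl fun i hi => by rw [(Finset.mem_filter.1 hi).2]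
  rw [Finset.sum_congr rfl fun s _ => h2 s, sum_zmod_three]
  have hv : (2 : ZMod 3).val = 2 := rfl
  have hv1 : (1 : ZMod 3).val = 1 := rfl
  rw [hv, hv1, ZMod.val_zero]
  ring

/-- The linear conditions on the class moments of a word `c` expressing that its polynomial has
roots of multiplicity `5`, `3` and `2` at `1`, `ω` and `ω²`. -/
structure MomentConditions (ω : ZMod p) (c : ZMod (3 * p) → ZMod p) : Prop where
  zero : ∀ s, moment c s 0 = 0
  one : ∀ s, moment c s 1 = 0
  two : ∀ s : ZMod 3, moment c s 2 = moment c 0 2 * ω ^ s.val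
  three : moment c 0 3 + moment c 1 3 + moment c 2 3 = 0
  four : moment c 0 4 + moment c 1 4 + moment c 2 4 = 0

theorem forall_zmod_three {P : ZMod 3 → Prop} (h0 : P 0) (h1 : P 1) (h2 : P 2) (s : ZMod 3) :
    P s := by
  fin_cases s
  exacts [h0, h1, h2]

theorem MomentConditions.of_dvd {ω : ZMod p} (hω : ω ^ 2 + ω + 1 = 0) (h3 : (3 : ZMod p) ≠ 0)
    {c : ZMod (3 * p) → ZMod p} (h : genPoly ω ∣ wordPoly c) : MomentConditions ω c := by
  have hω3 : ω ^ 3 = 1 := by linear_combination (ω - 1) * hω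
  have d1 : (X - C (1 : ZMod p)) ^ 5 ∣ wordPoly c :=
    ((dvd_mul_right _ _).mul_right _).trans h
  have d2 : (X - C ω) ^ 3 ∣ wordPoly c :=
    ((dvd_mul_left _ _).mul_right _).trans h
  have d3 : (X - C (ω ^ 2)) ^ 2 ∣ wordPoly c := (dvd_mul_left _ _).trans h
  have e1 : ∀ k < 5, moment c 0 k + moment c 1 k + moment c 2 k = 0 := by
    intro k hk
    have := sum_mul_pow_val_eq_moments c (one_pow 3) k
    rw [sum_zmod_eq_zero_of_pow_dvd_wordPoly c d1 hk] at this
    linear_combination -this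
  have e2 : ∀ k < 3, moment c 0 k + ω * moment c 1 k + ω ^ 2 * moment c 2 k = 0 := by
    intro k hk
    rw [← sum_mul_pow_val_eq_moments c hω3, sum_zmod_eq_zero_of_pow_dvd_wordPoly c d2 hk]
  have e3 : ∀ k < 2, moment c 0 k + ω ^ 2 * moment c 1 k + ω * moment c 2 k = 0 := by
    intro k hk
    have := sum_mul_pow_val_eq_moments c (r := ω ^ 2) (by rw [← pow_mul, mul_comm, pow_mul, hω3,
      one_pow]) k
    rw [sum_zmod_eq_zero_of_pow_dvd_wordPoly c d3 hk] at this
    linear_combination -this - ω * moment c 2 k * hω3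
  -- For `k < 2` the three equations form an invertible Vandermonde system (a discrete Fourier
  -- transform over `ℤ/3ℤ`).
  have e0 : ∀ k < 2, ∀ s, moment c s k = 0 := by
    intro k hk
    have a1 := e1 k (by omega)
    have a2 := e2 k (by omega)
    have a3 := e3 k hk
    refine forall_zmod_three ?_ ?_ ?_ <;> apply mul_left_cancel₀ h3
    · linear_combination a1 + a2 + a3 - (moment c 1 k + moment c 2 k) * hω
    · linear_combination a1 + ω ^ 2 * a2 + ω * a3 - (moment c 0 k + moment c 2 k) * hω
        - (2 * moment c 1 k + ω * moment c 2 k) * hω3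
    · linear_combination a1 + ω * a2 + ω ^ 2 * a3 - (moment c 0 k + moment c 1 k) * hω
        - (2 * moment c 2 k + ω * moment c 1 k) * hω3
  refine ⟨e0 0 (by omega), e0 1 (by omega), ?_, e1 3 (by omega), e1 4 (by omega)⟩
  have a1 := e1 2 (by omega)
  have a2 := e2 2 (by omega)
  have hne : ω - 1 ≠ 0 := by
    intro h0
    apply h3
    linear_combination hω - (ω + 2) * h0
  have h1 : moment c 1 2 = moment c 0 2 * ω := by
    apply mul_left_cancel₀ hne
    linear_combination ω ^ 2 * (ω ^ 2 * a1 - a2)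
      - (ω * moment c 0 2 + (ω - 1) * moment c 1 2) * hω3
  refine forall_zmod_three (by simp) ?_ ?_
  · change _ = _ * ω ^ 1
    rw [h1, pow_one]
  · change _ = _ * ω ^ 2
    linear_combination a1 - h1 - moment c 0 2 * hω

end Classes

/-! ### Words whose second moments vanish -/

section LowerBound

variable {p : ℕ} [Fact p.Prime] {ω : ZMod p} {c : ZMod (3 * p) → ZMod p}

theorem moment_eq_zero_of_classSupport_eq_empty {s : ZMod 3} (h : (classSupport c s).card = 0)
    (k : ℕ) : moment c s k = 0 := by
  rw [moment_eq_sum_classSupport, Finset.card_eq_zero.1 h, Finset.sum_empty]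

theorem MomentConditions.moment_two_eq_zero (hc : MomentConditions ω c)
    (h2 : moment c 0 2 = 0) (s : ZMod 3) : moment c s 2 = 0 := by
  rw [hc.two, h2, zero_mul]

theorem MomentConditions.three_le_card_classSupport (hc : MomentConditions ω c) (h3 : p ≠ 3)
    {s : ZMod 3} (hs : (classSupport c s).card ≠ 0) : 3 ≤ (classSupport c s).card := by
  refine lt_card_classSupport h3 (Finset.card_ne_zero.1 hs) (m := 2) fun k hk => ?_
  interval_cases k
  exacts [hc.zero s, hc.one s]

theorem MomentConditions.four_le_card_classSupport (hc : MomentConditions ω c) (h3 : p ≠ 3)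
    (h2 : moment c 0 2 = 0) {s : ZMod 3} (hs : (classSupport c s).card ≠ 0) :
    4 ≤ (classSupport c s).card := by
  refine lt_card_classSupport h3 (Finset.card_ne_zero.1 hs) (m := 3) fun k hk => ?_
  interval_cases k
  exacts [hc.zero s, hc.one s, hc.moment_two_eq_zero h2 s]

/-- If the support lies in a single class modulo `3`, the third and fourth moments of that class
vanish as well. -/
theorem MomentConditions.six_le_card_classSupport (hc : MomentConditions ω c) (h3 : p ≠ 3)
    (h2 : moment c 0 2 = 0) {s : ZMod 3} (hs : (classSupport c s).card ≠ 0)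
    (hsingle : ∀ u ≠ s, (classSupport c u).card = 0) : 6 ≤ (classSupport c s).card := by
  have hsum : ∀ k, ∑ u, moment c u k = moment c s k := fun k =>
    Finset.sum_eq_single s
      (fun u _ hu => moment_eq_zero_of_classSupport_eq_empty (hsingle u hu) k) (by simp)
  refine lt_card_classSupport h3 (Finset.card_ne_zero.1 hs) (m := 5) fun k hk => ?_
  interval_cases k
  · exact hc.zero s
  · exact hc.one s
  · exact hc.moment_two_eq_zero h2 s
  · rw [← hsum, sum_zmod_three, hc.three]
  · rw [← hsum, sum_zmod_three, hc.four]

/-- When one of the three classes modulo `3` is empty, a run of the support has length at most two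
and meets each of the other two classes at most once. -/
theorem card_filter_add_one_mem_wordSupport_le {s : ZMod 3} (hs : (classSupport c s).card = 0) :
    ((wordSupport c).filter fun i => i + 1 ∈ wordSupport c).card ≤ (classSupport c (s + 1)).card ∧
    ((wordSupport c).filter fun i => i + 1 ∈ wordSupport c).card
      ≤ (classSupport c (s + 2)).card := by
  have hne : ∀ i ∈ wordSupport c, residue p i ≠ s := by
    intro i hi h
    have : i ∈ classSupport c s := Finset.mem_filter.2 ⟨hi, h⟩
    rw [Finset.card_eq_zero.1 hs] at this
    exact Finset.notMem_empty _ this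
  have hres : ∀ s t : ZMod 3, t ≠ s → t + 1 ≠ s → t = s + 1 ∧ t + 1 = s + 2 := by decide
  have hcl : ∀ i ∈ (wordSupport c).filter fun i => i + 1 ∈ wordSupport c,
      residue p i = s + 1 ∧ residue p (i + 1) = s + 2 := by
    intro i hi
    have h := Finset.mem_filter.1 hi
    have h1 := hne _ h.2
    rw [map_add, map_one] at h1 ⊢
    exact hres _ _ (hne _ h.1) h1
  constructor
  · refine Finset.card_le_card fun i hi => Finset.mem_filter.2 ⟨?_, (hcl i hi).1⟩
    exact (Finset.mem_filter.1 hi).1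
  · refine Finset.card_le_card_of_injOn (· + 1) (fun i hi => ?_) (add_left_injective 1).injOn
    exact Finset.mem_coe.2 (Finset.mem_filter.2 ⟨(Finset.mem_filter.1 hi).2, (hcl i hi).2⟩)

theorem MomentConditions.twelve_le_pairWeight (hc : MomentConditions ω c) (h3 : p ≠ 3)
    (h2 : moment c 0 2 = 0) (hne : c ≠ 0) : 12 ≤ pairWeight c := by
  have h4 : ∀ s, (classSupport c s).card ≠ 0 → 4 ≤ (classSupport c s).card := fun s =>
    hc.four_le_card_classSupport h3 h2
  by_cases hall : ∀ s, (classSupport c s).card ≠ 0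
  · have h := pairWeight_eq_card_add_card_gaps c
    rw [card_wordSupport_eq_sum, sum_zmod_three] at h
    have := h4 0 (hall 0)
    have := h4 1 (hall 1)
    have := h4 2 (hall 2)
    omega
  · push Not at hall
    obtain ⟨s, hs⟩ := hall
    have hpw := pairWeight_add_card_inter c
    obtain ⟨hN1, hN2⟩ := card_filter_add_one_mem_wordSupport_le hs
    have hcard := card_wordSupport_eq_sum c
    rw [sum_zmod_three_shift s] at hcard
    have hpos : (wordSupport c).card ≠ 0 := by
      obtain ⟨i, hi⟩ := Function.ne_iff.1 hne
      exact Finset.card_ne_zero.2 ⟨i, mem_wordSupport.2 hi⟩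
    have hcases : ∀ s u : ZMod 3, u = s ∨ u = s + 1 ∨ u = s + 2 := by decide
    have h61 : (classSupport c (s + 2)).card = 0 → (classSupport c (s + 1)).card ≠ 0 →
        6 ≤ (classSupport c (s + 1)).card := by
      intro h0 h1
      refine hc.six_le_card_classSupport h3 h2 h1 fun u hu => ?_
      rcases hcases s u with rfl | rfl | rfl
      exacts [hs, absurd rfl hu, h0]
    have h62 : (classSupport c (s + 1)).card = 0 → (classSupport c (s + 2)).card ≠ 0 →
        6 ≤ (classSupport c (s + 2)).card := by
      intro h0 h1
      refine hc.six_le_card_classSupport h3 h2 h1 fun u hu => ?_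
      rcases hcases s u with rfl | rfl | rfl
      exacts [hs, h0, absurd rfl hu]
    have := h4 (s + 1)
    have := h4 (s + 2)
    omega

/-! ### Supports consisting of two runs -/

/-- The complete homogeneous symmetric polynomial of degree two in three variables. -/
def hsymmTwo (x y z : ZMod p) : ZMod p := x ^ 2 + y ^ 2 + z ^ 2 + x * y + y * z + z * x

theorem MomentConditions.moment_two_eq_zero_of_nodes (hc : MomentConditions ω c) {s : ZMod 3}
    {x y : ZMod p} (h : ∀ i, c i ≠ 0 → residue p i = s → node p i = x ∨ node p i = y) :
    moment c s 2 = 0 := by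
  have h0 : ∑ i with residue p i = s, c i * ((node p i - x) * (node p i - y)) = 0 := by
    refine Finset.sum_eq_zero fun i hi => ?_
    by_cases hci : c i = 0
    · rw [hci, zero_mul]
    · rcases h i hci (Finset.mem_filter.1 hi).2 with h | h <;> rw [h] <;> ring
  have h1 : ∑ i with residue p i = s, c i * ((node p i - x) * (node p i - y))
      = moment c s 2 - (x + y) * moment c s 1 + x * y * moment c s 0 := by
    simp only [moment, Finset.mul_sum, ← Finset.sum_add_distrib, ← Finset.sum_sub_distrib]
    exact Finset.sum_congr rfl fun i _ => by ring
  rw [h1, hc.zero, hc.one] at h0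
  linear_combination h0

/-- If a class is supported on three nodes `x, y, z`, then after the vanishing moments of order
`0` and `1` the next ones are in the ratio `1 : h₁(x, y, z) : h₂(x, y, z)` of complete homogeneous
symmetric polynomials. -/
theorem MomentConditions.moments_of_nodes (hc : MomentConditions ω c) {s : ZMod 3}
    {x y z : ZMod p}
    (h : ∀ i, c i ≠ 0 → residue p i = s → node p i = x ∨ node p i = y ∨ node p i = z) :
    moment c s 3 = (x + y + z) * moment c s 2 ∧
      moment c s 4 = hsymmTwo x y z * moment c s 2 := by
  have h0 : ∀ k, ∑ i with residue p i = s,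
      c i * ((node p i - x) * (node p i - y) * (node p i - z) * node p i ^ k) = 0 := by
    intro k
    refine Finset.sum_eq_zero fun i hi => ?_
    by_cases hci : c i = 0
    · rw [hci, zero_mul]
    · rcases h i hci (Finset.mem_filter.1 hi).2 with h | h | h <;> rw [h] <;> ring
  have h1 : ∀ k, ∑ i with residue p i = s,
      c i * ((node p i - x) * (node p i - y) * (node p i - z) * node p i ^ k)
      = moment c s (k + 3) - (x + y + z) * moment c s (k + 2)
        + (x * y + y * z + z * x) * moment c s (k + 1) - x * y * z * moment c s k := by
    intro k
    simp only [moment, Finset.mul_sum, ← Finset.sum_add_distrib, ← Finset.sum_sub_distrib]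
    exact Finset.sum_congr rfl fun i _ => by ring
  have e0 := (h1 0).symm.trans (h0 0)
  have e1 := (h1 1).symm.trans (h0 1)
  norm_num [hc.zero s, hc.one s] at e0 e1
  have e2 : moment c s 3 = (x + y + z) * moment c s 2 := by linear_combination e0
  refine ⟨e2, ?_⟩
  rw [e2] at e1
  unfold hsymmTwo
  linear_combination e1

theorem MomentConditions.sum_symm_eq_zero (hc : MomentConditions ω c) (h2 : moment c 0 2 ≠ 0)
    {x y z x' y' z' x'' y'' z'' : ZMod p}
    (h : ∀ i, c i ≠ 0 → residue p i = (0 : ℕ) → node p i = x ∨ node p i = y ∨ node p i = z)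
    (h' : ∀ i, c i ≠ 0 → residue p i = (1 : ℕ) → node p i = x' ∨ node p i = y' ∨ node p i = z')
    (h'' : ∀ i, c i ≠ 0 → residue p i = (2 : ℕ) →
      node p i = x'' ∨ node p i = y'' ∨ node p i = z'') :
    (x + y + z) + ω * (x' + y' + z') + ω ^ 2 * (x'' + y'' + z'') = 0 ∧
    hsymmTwo x y z + ω * hsymmTwo x' y' z' + ω ^ 2 * hsymmTwo x'' y'' z'' = 0 := by
  obtain ⟨a1, a2⟩ := hc.moments_of_nodes h
  obtain ⟨b1, b2⟩ := hc.moments_of_nodes h'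
  obtain ⟨d1, d2⟩ := hc.moments_of_nodes h''
  have e1 : moment c ((1 : ℕ) : ZMod 3) 2 = moment c 0 2 * ω ^ 1 := hc.two 1
  have e2 : moment c ((2 : ℕ) : ZMod 3) 2 = moment c 0 2 * ω ^ 2 := hc.two 2
  have e3 : moment c ((0 : ℕ) : ZMod 3) 3 + moment c ((1 : ℕ) : ZMod 3) 3
    + moment c ((2 : ℕ) : ZMod 3) 3 = 0 := hc.three
  have e4 : moment c ((0 : ℕ) : ZMod 3) 4 + moment c ((1 : ℕ) : ZMod 3) 4
    + moment c ((2 : ℕ) : ZMod 3) 4 = 0 := hc.four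
  rw [a1, b1, d1, e1, e2, Nat.cast_zero] at e3
  rw [a2, b2, d2, e1, e2, Nat.cast_zero] at e4
  constructor <;> apply mul_left_cancel₀ h2
  · linear_combination e3
  · linear_combination e4

/-- The nodes of one residue class in the union of the runs `0, …, a - 1` and
`t, …, t + b - 1`. -/
theorem nodes_of_two_runs {a b ρ : ℕ} {t : ZMod (3 * p)} (hρ : residue p t = ρ)
    (hS : ∀ i, c i ≠ 0 → (∃ k < a, i = (k : ℕ)) ∨ (∃ k < b, i = t + (k : ℕ)))
    {s : ℕ} {x y z : ZMod p}
    (h1 : ∀ k < a, k % 3 = s % 3 → (k : ZMod p) = x ∨ (k : ZMod p) = y ∨ (k : ZMod p) = z)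
    (h2 : ∀ k < b, (ρ + k) % 3 = s % 3 →
      node p t + k = x ∨ node p t + k = y ∨ node p t + k = z) :
    ∀ i, c i ≠ 0 → residue p i = s → node p i = x ∨ node p i = y ∨ node p i = z := by
  intro i hi hs
  rcases hS i hi with ⟨k, hk, rfl⟩ | ⟨k, hk, rfl⟩
  · rw [map_natCast] at hs ⊢
    exact h1 k hk ((ZMod.natCast_eq_natCast_iff' _ _ 3).1 hs)
  · rw [map_add, map_natCast, hρ, ← Nat.cast_add] at hs
    rw [map_add, map_natCast]
    exact h2 k hk ((ZMod.natCast_eq_natCast_iff' _ _ 3).1 hs)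

/-- A support contained in two runs of total length nine, the longer of which starts at `0`, is
impossible for a word with nonzero second moments. Such a support has at most two nodes in some
class modulo `3`, or at most three in each; in the latter case the two resulting equations in `ω`
and the offset of the second run are incompatible away from the characteristics `2, 3, 5`. -/
theorem MomentConditions.false_of_two_runs (hc : MomentConditions ω c)
    (hω : ω ^ 2 + ω + 1 = 0) (h2 : moment c 0 2 ≠ 0)
    (h15 : (15 : ZMod p) ≠ 0) (h6 : (6 : ZMod p) ≠ 0) {a : ℕ} (ha : 5 ≤ a) (ha' : a ≤ 8)
    {t : ZMod (3 * p)}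
    (hS : ∀ i, c i ≠ 0 → (∃ k < a, i = (k : ℕ)) ∨ (∃ k < 9 - a, i = t + (k : ℕ))) : False := by
  have h3 : (3 : ZMod p) ≠ 0 := fun h => h6 (by linear_combination 2 * h)
  have hω0 : ω ≠ 0 := by
    rintro rfl
    norm_num at hω
  have htwo : ∀ (s : ℕ) (x y : ZMod p), (∀ i, c i ≠ 0 → residue p i = s →
      node p i = x ∨ node p i = y ∨ node p i = y) → False := by
    intro s x y h
    have h0 := hc.moment_two_eq_zero_of_nodes (s := s) (x := x) (y := y) fun i hi hs => by
      simpa using h i hi hs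
    rw [hc.two] at h0
    exact mul_ne_zero h2 (pow_ne_zero _ hω0) h0
  set τ := node p t with hτ
  obtain ⟨ρ, hρ3, hρ⟩ : ∃ ρ < 3, residue p t = (ρ : ℕ) :=
    ⟨(residue p t).val, ZMod.val_lt _, by simp⟩
  interval_cases a <;> interval_cases ρ
  -- In the balanced cases the equation of order three either determines `τ` or is contradictory.
  -- Runs of lengths five and four.
  · refine htwo 2 2 (τ + 2) (nodes_of_two_runs hρ hS ?_ ?_) <;> intro k hk hs <;>
      interval_cases k <;> first | omega | simp [hτ]
  · refine htwo 2 2 (τ + 1) (nodes_of_two_runs hρ hS ?_ ?_) <;> intro k hk hs <;>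
      interval_cases k <;> first | omega | simp [hτ]
  · have h := hc.sum_symm_eq_zero h2
      (x := 0) (y := 3) (z := τ + 1) (x' := 1) (y' := 4) (z' := τ + 2)
      (x'' := 2) (y'' := τ) (z'' := τ + 3)
      (nodes_of_two_runs hρ hS ?_ ?_) (nodes_of_two_runs hρ hS ?_ ?_)
      (nodes_of_two_runs hρ hS ?_ ?_)
    · clear_value τ
      clear hτ hS htwo hc hρ
      obtain ⟨h, h'⟩ := h
      unfold hsymmTwo at h'
      have hτω : τ = 2 + 3 * ω := by grind
      exact h6 (by grind)
    all_goals
      intro k hk hs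
      interval_cases k <;> first | omega | simp [hτ]
  -- Runs of lengths six and three.
  · have h := hc.sum_symm_eq_zero h2
      (x := 0) (y := 3) (z := τ) (x' := 1) (y' := 4) (z' := τ + 1)
      (x'' := 2) (y'' := 5) (z'' := τ + 2)
      (nodes_of_two_runs hρ hS ?_ ?_) (nodes_of_two_runs hρ hS ?_ ?_)
      (nodes_of_two_runs hρ hS ?_ ?_)
    · clear_value τ
      clear hτ hS htwo hc hρ
      obtain ⟨h, h'⟩ := h
      unfold hsymmTwo at h'
      -- Here the equation of order three does not involve `τ` and reads `3 (ω + 2) = 0`.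
      have hω2 : ω = -2 := mul_left_cancel₀ h3 (by grind)
      rw [hω2] at hω
      exact h3 (by linear_combination hω)
    all_goals
      intro k hk hs
      interval_cases k <;> first | omega | simp [hτ]
  · have h := hc.sum_symm_eq_zero h2
      (x := 0) (y := 3) (z := τ + 2) (x' := 1) (y' := 4) (z' := τ)
      (x'' := 2) (y'' := 5) (z'' := τ + 1)
      (nodes_of_two_runs hρ hS ?_ ?_) (nodes_of_two_runs hρ hS ?_ ?_)
      (nodes_of_two_runs hρ hS ?_ ?_)
    · clear_value τ
      clear hτ hS htwo hc hρ
      obtain ⟨h, h'⟩ := h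
      unfold hsymmTwo at h'
      grind
    all_goals
      intro k hk hs
      interval_cases k <;> first | omega | simp [hτ]
  · have h := hc.sum_symm_eq_zero h2
      (x := 0) (y := 3) (z := τ + 1) (x' := 1) (y' := 4) (z' := τ + 2)
      (x'' := 2) (y'' := 5) (z'' := τ)
      (nodes_of_two_runs hρ hS ?_ ?_) (nodes_of_two_runs hρ hS ?_ ?_)
      (nodes_of_two_runs hρ hS ?_ ?_)
    · clear_value τ
      clear hτ hS htwo hc hρ
      obtain ⟨h, h'⟩ := h
      unfold hsymmTwo at h'
      grind
    all_goals
      intro k hk hs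
      interval_cases k <;> first | omega | simp [hτ]
  -- Runs of lengths seven and two.
  · refine htwo 2 2 5 (nodes_of_two_runs hρ hS ?_ ?_) <;> intro k hk hs <;>
      interval_cases k <;> first | omega | simp
  · have h := hc.sum_symm_eq_zero h2
      (x := 0) (y := 3) (z := 6) (x' := 1) (y' := 4) (z' := τ)
      (x'' := 2) (y'' := 5) (z'' := τ + 1)
      (nodes_of_two_runs hρ hS ?_ ?_) (nodes_of_two_runs hρ hS ?_ ?_)
      (nodes_of_two_runs hρ hS ?_ ?_)
    · clear_value τ
      clear hτ hS htwo hc hρ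
      obtain ⟨h, h'⟩ := h
      unfold hsymmTwo at h'
      have hτω : τ = 1 - 3 * ω := by grind
      grind
    all_goals
      intro k hk hs
      interval_cases k <;> first | omega | simp [hτ]
  · refine htwo 1 1 4 (nodes_of_two_runs hρ hS ?_ ?_) <;> intro k hk hs <;>
      interval_cases k <;> first | omega | simp
  -- Runs of lengths eight and one.
  · refine htwo 2 2 5 (nodes_of_two_runs hρ hS ?_ ?_) <;> intro k hk hs <;>
      interval_cases k <;> first | omega | simp
  · refine htwo 2 2 5 (nodes_of_two_runs hρ hS ?_ ?_) <;> intro k hk hs <;>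
      interval_cases k <;> first | omega | simp
  · have h := hc.sum_symm_eq_zero h2
      (x := 0) (y := 3) (z := 6) (x' := 1) (y' := 4) (z' := 7)
      (x'' := 2) (y'' := 5) (z'' := τ)
      (nodes_of_two_runs hρ hS ?_ ?_) (nodes_of_two_runs hρ hS ?_ ?_)
      (nodes_of_two_runs hρ hS ?_ ?_)
    · clear_value τ
      clear hτ hS htwo hc hρ
      obtain ⟨h, h'⟩ := h
      unfold hsymmTwo at h'
      have hτω : τ = 5 + 3 * ω := by grind
      exact h15 (by grind)
    all_goals
      intro k hk hs
      interval_cases k <;> first | omega | simp [hτ]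

end LowerBound

/-! ### The pair distance of the code -/

section Code

variable {p : ℕ} [Fact p.Prime] {ω : ZMod p}

theorem genPoly_monic (ω : ZMod p) : (genPoly ω).Monic :=
  (((monic_X_sub_C _).pow 5).mul ((monic_X_sub_C _).pow 3)).mul ((monic_X_sub_C _).pow 2)

theorem natDegree_genPoly (ω : ZMod p) : (genPoly ω).natDegree = 10 := by
  rw [genPoly, Monic.natDegree_mul (((monic_X_sub_C _).pow 5).mul ((monic_X_sub_C _).pow 3))
    ((monic_X_sub_C _).pow 2), Monic.natDegree_mul ((monic_X_sub_C _).pow 5)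
    ((monic_X_sub_C _).pow 3)]
  simp only [natDegree_pow, natDegree_X_sub_C]

theorem X_pow_three_sub_one_eq (hω : ω ^ 2 + ω + 1 = 0) :
    (X ^ 3 - 1 : (ZMod p)[X]) = (X - C 1) * (X - C ω) * (X - C (ω ^ 2)) := by
  have h : (C ω : (ZMod p)[X]) ^ 2 + C ω + 1 = 0 := by
    rw [← C_pow, ← C_1, ← C_add, ← C_add, hω, C_0]
  rw [C_pow, C_1]
  linear_combination (X ^ 2 - X * C ω + C ω - 1) * h

theorem genPoly_dvd_X_pow_three_sub_one_pow (hω : ω ^ 2 + ω + 1 = 0) {m : ℕ} (hm : 5 ≤ m) :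
    genPoly ω ∣ (X ^ 3 - 1) ^ m := by
  rw [X_pow_three_sub_one_eq hω, mul_pow, mul_pow]
  exact mul_dvd_mul (mul_dvd_mul (pow_dvd_pow _ hm) (pow_dvd_pow _ (by omega)))
    (pow_dvd_pow _ (by omega))

theorem genPoly_dvd_X_pow_sub_one (hω : ω ^ 2 + ω + 1 = 0) (hp : 5 ≤ p) :
    genPoly ω ∣ X ^ (3 * p) - 1 := by
  have h := genPoly_dvd_X_pow_three_sub_one_pow hω hp
  rwa [sub_pow_char, one_pow, ← pow_mul] at h

/-- A nonzero codeword is not supported on ten consecutive positions: after a translation its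
polynomial would have degree less than that of the generator polynomial. -/
theorem eq_zero_of_mem_of_run (hω : ω ^ 2 + ω + 1 = 0) (hp : 7 ≤ p)
    {c : ZMod (3 * p) → ZMod p} (hc : c ∈ cyclicCode (3 * p) (genPoly ω)) {j : ZMod (3 * p)}
    (hj : ∀ i, c i ≠ 0 → ∃ k : ℕ, k < 10 ∧ i = j + k) : c = 0 := by
  have hg := genPoly_dvd_X_pow_sub_one hω (by omega : 5 ≤ p)
  set c' : ZMod (3 * p) → ZMod p := fun i => c (i + j) with hc'
  have hdvd := (mem_cyclicCode_iff hg).1 ((isCyclicCode_cyclicCode _).translate_mem hc j)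
  rw [← hc'] at hdvd
  have hzero : wordPoly c' = 0 := by
    refine eq_zero_of_dvd_of_degree_lt hdvd ?_
    rw [degree_eq_natDegree (genPoly_monic ω).ne_zero, natDegree_genPoly,
      degree_lt_iff_coeff_zero]
    intro m hm
    rw [coeff_wordPoly]
    split_ifs with hmn
    · by_contra hne
      obtain ⟨k, hk, h⟩ := hj _ hne
      rw [add_comm, add_right_inj, ZMod.natCast_eq_natCast_iff', Nat.mod_eq_of_lt hmn,
        Nat.mod_eq_of_lt (by omega)] at h
      omega
    · rfl
  ext i
  have h := coeff_wordPoly_val c' (i - j)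
  rw [hzero, coeff_zero] at h
  simpa [hc'] using h.symm

theorem natCast_ne_zero_of_prime_lt {q : ℕ} (hq : q.Prime) (hp : q < p) : (q : ZMod p) ≠ 0 := by
  rw [Ne, ZMod.natCast_eq_zero_iff]
  exact fun h => absurd (Nat.le_of_dvd hq.pos h) (by omega)

/-- The pair weight of a nonzero codeword is at least `12`. If it were less, then no translate
could have vanishing second moments; so each class modulo `3` contains at least three positions of
the support, which then is a run of length at most ten or two runs of total length nine. -/
theorem twelve_le_pairWeight_of_mem (hω : ω ^ 2 + ω + 1 = 0) (hp : 7 ≤ p)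
    {c : ZMod (3 * p) → ZMod p} (hc : c ∈ cyclicCode (3 * p) (genPoly ω)) (hne : c ≠ 0) :
    12 ≤ pairWeight c := by
  by_contra! hlt
  have hg := genPoly_dvd_X_pow_sub_one hω (by omega : 5 ≤ p)
  have n2 : (2 : ZMod p) ≠ 0 := by
    exact_mod_cast natCast_ne_zero_of_prime_lt (p := p) Nat.prime_two (by omega)
  have n3 : (3 : ZMod p) ≠ 0 := by
    exact_mod_cast natCast_ne_zero_of_prime_lt (p := p) Nat.prime_three (by omega)
  have n5 : (5 : ZMod p) ≠ 0 := by
    exact_mod_cast natCast_ne_zero_of_prime_lt (p := p) Nat.prime_five (by omega)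
  have hp3 : p ≠ 3 := by omega
  have hM : ∀ j : ZMod (3 * p), MomentConditions ω (fun i => c (i + j)) := fun j =>
    .of_dvd hω n3 ((mem_cyclicCode_iff hg).1 ((isCyclicCode_cyclicCode _).translate_mem hc j))
  have h2 : ∀ j : ZMod (3 * p), moment (fun i => c (i + j)) 0 2 ≠ 0 := by
    intro j h
    have := (hM j).twelve_le_pairWeight hp3 h (by
      intro h0
      refine hne (funext fun i => ?_)
      simpa using congrFun h0 (i - j))
    rw [pairWeight_translate] at this
    omega
  have hM0 : MomentConditions ω c := by simpa using hM 0
  have h20 : moment c 0 2 ≠ 0 := by simpa using h2 0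
  have hω0 : ω ≠ 0 := by
    rintro rfl
    norm_num at hω
  have hclass : ∀ s, 3 ≤ (classSupport c s).card := by
    refine fun s => hM0.three_le_card_classSupport hp3 fun h => ?_
    have := moment_eq_zero_of_classSupport_eq_empty h 2
    rw [hM0.two] at this
    exact mul_ne_zero h20 (pow_ne_zero _ hω0) this
  have hcard := card_wordSupport_eq_sum c
  rw [sum_zmod_three] at hcard
  have := hclass 0
  have := hclass 1
  have := hclass 2
  have hpw := pairWeight_eq_card_add_card_gaps c
  obtain ⟨ℓ, hcover, hsum⟩ := exists_run_lengths (S := wordSupport c) (by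
    intro h
    have : (wordSupport c).card = 3 * p := by rw [h, Finset.card_univ, ZMod.card]
    omega)
  have hone : ∀ g, (∀ i, c i ≠ 0 → ∃ d, 1 ≤ d ∧ d ≤ 10 ∧ i = g + (d : ℕ)) → False := by
    intro g h
    refine hne (eq_zero_of_mem_of_run hω hp hc (j := g + 1) fun i hi => ?_)
    obtain ⟨d, hd1, hd2, rfl⟩ := h i hi
    refine ⟨d - 1, by omega, ?_⟩
    rw [Nat.cast_sub hd1]
    push_cast
    ring
  have htwo : ∀ g g' : ZMod (3 * p), ∀ a a' : ℕ, (∀ i, c i ≠ 0 →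
      (∃ d, 1 ≤ d ∧ d ≤ a ∧ i = g + (d : ℕ)) ∨ (∃ d, 1 ≤ d ∧ d ≤ a' ∧ i = g' + (d : ℕ))) →
      a + a' = 9 → a' ≤ a → False := by
    intro g g' a a' h haa hle
    by_cases ha : a = 9
    · refine hone g fun i hi => ?_
      rcases h i hi with ⟨d, h1, h2, h3⟩ | ⟨d, h1, h2, h3⟩
      · exact ⟨d, h1, by omega, h3⟩
      · omega
    · refine (hM (g + 1)).false_of_two_runs hω (h2 (g + 1)) ?_ ?_ (a := a) (by omega) (by omega)
        (t := g' - g) fun i hi => ?_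
      · have := mul_ne_zero n3 n5
        norm_num at this
        exact this
      · have := mul_ne_zero n2 n3
        norm_num at this
        exact this
      · rcases h _ hi with ⟨d, h1, h2, h3⟩ | ⟨d, h1, h2, h3⟩
        · refine Or.inl ⟨d - 1, by omega, ?_⟩
          rw [Nat.cast_sub h1]
          push_cast
          linear_combination h3
        · refine Or.inr ⟨d - 1, by omega, ?_⟩
          rw [Nat.cast_sub h1]
          push_cast
          linear_combination h3
  have hle : (gaps (wordSupport c)).card ≤ 2 := by omega
  interval_cases hG : (gaps (wordSupport c)).card
  · rw [Finset.card_eq_zero.1 hG, Finset.sum_empty] at hsum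
    omega
  · obtain ⟨g, hg⟩ := Finset.card_eq_one.1 hG
    rw [hg, Finset.sum_singleton] at hsum
    refine hone g fun i hi => ?_
    obtain ⟨g', hg', d, h1, h2, h3⟩ := hcover i (mem_wordSupport.2 hi)
    rw [hg, Finset.mem_singleton] at hg'
    subst hg'
    exact ⟨d, h1, by omega, h3⟩
  · obtain ⟨g, g', hgg, hg⟩ := Finset.card_eq_two.1 hG
    rw [hg, Finset.sum_pair hgg] at hsum
    have h : ∀ i, c i ≠ 0 → (∃ d, 1 ≤ d ∧ d ≤ ℓ g ∧ i = g + (d : ℕ)) ∨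
        (∃ d, 1 ≤ d ∧ d ≤ ℓ g' ∧ i = g' + (d : ℕ)) := by
      intro i hi
      obtain ⟨γ, hγ, d, hd⟩ := hcover i (mem_wordSupport.2 hi)
      rw [hg, Finset.mem_insert, Finset.mem_singleton] at hγ
      rcases hγ with rfl | rfl
      exacts [Or.inl ⟨d, hd⟩, Or.inr ⟨d, hd⟩]
    rcases le_total (ℓ g') (ℓ g) with hle | hle
    · exact htwo g g' _ _ h (by omega) hle
    · exact htwo g' g _ _ (fun i hi => (h i hi).symm) (by omega) hle

theorem six_le_card_wordSupport_of_mem (hω : ω ^ 2 + ω + 1 = 0) (hp : 7 ≤ p)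
    {c : ZMod (3 * p) → ZMod p} (hc : c ∈ cyclicCode (3 * p) (genPoly ω)) (hne : c ≠ 0) :
    6 ≤ (wordSupport c).card := by
  have h1 := twelve_le_pairWeight_of_mem hω hp hc hne
  have h2 := pairWeight_add_card_inter c
  omega

/-- The word of `(X³ - 1)⁵`, whose six monomials are `1, X³, …, X¹⁵`, is a codeword. -/
theorem exists_mem_card_wordSupport_le_six (hω : ω ^ 2 + ω + 1 = 0) (hp : 7 ≤ p) :
    ∃ c ∈ cyclicCode (3 * p) (genPoly ω), c ≠ 0 ∧ (wordSupport c).card ≤ 6 := by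
  have hg := genPoly_dvd_X_pow_sub_one hω (by omega : 5 ≤ p)
  set f : (ZMod p)[X] := (X ^ 3 - 1) ^ 5 with hf
  have hmonic : f.Monic := by
    rw [hf, ← C_1]
    exact (monic_X_pow_sub_C 1 (by norm_num)).pow 5
  have hdeg : f.degree < (3 * p : ℕ) := by
    rw [degree_eq_natDegree hmonic.ne_zero, hf, natDegree_pow, ← C_1, natDegree_X_pow_sub_C]
    norm_cast
    omega
  have hword := wordPoly_coeff_eq hdeg
  refine ⟨fun i => f.coeff i.val, ?_, ?_, ?_⟩
  · rw [mem_cyclicCode_iff hg, hword]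
    exact genPoly_dvd_X_pow_three_sub_one_pow hω le_rfl
  · intro h
    rw [h] at hword
    exact hmonic.ne_zero (by rw [← hword]; simp [wordPoly])
  · have hcoeff : ∀ m, f.coeff m ≠ 0 → ∃ k < 6, m = 3 * k := by
      intro m hm
      rw [hf, sub_eq_add_neg, add_pow, finsetSum_coeff] at hm
      obtain ⟨k, hk, hne⟩ := Finset.exists_ne_zero_of_sum_ne_zero hm
      refine ⟨k, Finset.mem_range.1 hk, ?_⟩
      by_contra hmk
      apply hne
      have : ((X ^ 3) ^ k * (-1) ^ (5 - k) * ((Nat.choose 5 k : ℕ) : (ZMod p)[X]))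
          = C ((-1) ^ (5 - k) * (Nat.choose 5 k : ZMod p)) * X ^ (3 * k) := by
        rw [pow_mul]
        simp only [map_mul, map_pow, map_neg, map_one, map_natCast]
        ring
      rw [this, coeff_C_mul, coeff_X_pow, if_neg hmk, mul_zero]
    calc _ ≤ ((Finset.range 6).image fun k : ℕ => ((3 * k : ℕ) : ZMod (3 * p))).card := by
          refine Finset.card_le_card fun i hi => ?_
          obtain ⟨k, hk, h⟩ := hcoeff _ (mem_wordSupport.1 hi)
          refine Finset.mem_image.2 ⟨k, Finset.mem_range.2 hk, ?_⟩
          rw [← h, ZMod.natCast_zmod_val]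
      _ ≤ 6 := Finset.card_image_le.trans (by simp)

theorem isMinHammingDist_cyclicCode_genPoly (hω : ω ^ 2 + ω + 1 = 0) (hp : 7 ≤ p) :
    IsMinHammingDist (cyclicCode (3 * p) (genPoly ω) : Set (ZMod (3 * p) → ZMod p)) 6 := by
  constructor
  · obtain ⟨c, hc, hne, hle⟩ := exists_mem_card_wordSupport_le_six hω hp
    refine ⟨c, hc, 0, zero_mem _, hne, ?_⟩
    rw [hammingDist_eq_card_wordSupport_sub, sub_zero]
    exact le_antisymm (six_le_card_wordSupport_of_mem hω hp hc hne) hle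
  · rintro _ ⟨x, hx, y, hy, hne, rfl⟩
    rw [hammingDist_eq_card_wordSupport_sub]
    exact six_le_card_wordSupport_of_mem hω hp (sub_mem hx hy) (sub_ne_zero.2 hne)

theorem isMinPairDist_cyclicCode_genPoly (hω : ω ^ 2 + ω + 1 = 0) (hp : 7 ≤ p) :
    IsMinPairDist (cyclicCode (3 * p) (genPoly ω) : Set (ZMod (3 * p) → ZMod p)) 12 := by
  constructor
  · obtain ⟨c, hc, hne, hle⟩ := exists_mem_card_wordSupport_le_six hω hp
    refine ⟨c, hc, 0, zero_mem _, hne, ?_⟩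
    rw [pairDist_eq_pairWeight_sub, sub_zero]
    have h1 := pairWeight_add_card_inter c
    have h2 := twelve_le_pairWeight_of_mem hω hp hc hne
    omega
  · rintro _ ⟨x, hx, y, hy, hne, rfl⟩
    rw [pairDist_eq_pairWeight_sub]
    exact twelve_le_pairWeight_of_mem hω hp (sub_mem hx hy) (sub_ne_zero.2 hne)

theorem finrank_cyclicCode_genPoly (hω : ω ^ 2 + ω + 1 = 0) (hp : 7 ≤ p) :
    Module.finrank (ZMod p) (cyclicCode (3 * p) (genPoly ω)) = 3 * p - 10 := by
  rw [finrank_cyclicCode (genPoly_monic ω) (genPoly_dvd_X_pow_sub_one hω (by omega)),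
    natDegree_genPoly]

theorem isMDSPairCode_cyclicCode_genPoly (hω : ω ^ 2 + ω + 1 = 0) (hp : 7 ≤ p) :
    IsMDSPairCode (cyclicCode (3 * p) (genPoly ω) : Set (ZMod (3 * p) → ZMod p)) 12 := by
  refine ⟨by norm_num, by omega, isMinPairDist_cyclicCode_genPoly hω hp, ?_⟩
  change Nat.card (cyclicCode (3 * p) (genPoly ω)) = _
  rw [Module.natCard_eq_pow_finrank (K := ZMod p), finrank_cyclicCode_genPoly hω hp]
  congr 1
  omega

end Code

end SymbolPair

theorem theorem3p2 (p : ℕ) [Fact p.Prime] (hodd : Odd p) (h3 : 3 ∣ p - 1) :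
    (∃ D : Set (ZMod (3 * p) → ZMod p), SymbolPair.IsMDSPairCode D 12) ∧
    ∀ ω : ZMod p, IsPrimitiveRoot ω 3 →
      ∃ D : Submodule (ZMod p) (ZMod (3 * p) → ZMod p),
        SymbolPair.IsRepeatedRootCyclicCode D ∧
        SymbolPair.IsGeneratorPoly D
          ((Polynomial.X - Polynomial.C 1) ^ 5 * (Polynomial.X - Polynomial.C ω) ^ 3 *
            (Polynomial.X - Polynomial.C (ω ^ 2)) ^ 2) ∧
        SymbolPair.IsLinearCodeWith D (3 * p - 10) 6 ∧
        SymbolPair.IsMinPairDist (D : Set (ZMod (3 * p) → ZMod p)) 12 ∧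
        SymbolPair.IsMDSPairCode (D : Set (ZMod (3 * p) → ZMod p)) 12 := by
  have hprime : p.Prime := Fact.out
  -- The prime `p` is odd and `1` modulo `3`.
  have hp : 7 ≤ p := by
    obtain ⟨m, hm⟩ := hodd
    have := hprime.two_le
    omega
  have hω : ∀ ω : ZMod p, IsPrimitiveRoot ω 3 → ω ^ 2 + ω + 1 = 0 := by
    intro ω h
    have := h.geom_sum_eq_zero (by norm_num)
    rw [Finset.sum_range_succ, Finset.sum_range_succ, Finset.sum_range_one] at this
    linear_combination this
  constructor
  · have h3' : 3 ∣ Fintype.card (ZMod p)ˣ := by rwa [ZMod.card_units]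
    obtain ⟨u, hu⟩ := exists_prime_orderOf_dvd_card 3 h3'
    have hprim : IsPrimitiveRoot (u : ZMod p) 3 :=
      IsPrimitiveRoot.coe_units_iff.2 (hu ▸ IsPrimitiveRoot.orderOf u)
    exact ⟨_, SymbolPair.isMDSPairCode_cyclicCode_genPoly (hω _ hprim) hp⟩
  · intro ω hprim
    have h := hω ω hprim
    refine ⟨SymbolPair.cyclicCode (3 * p) (SymbolPair.genPoly ω),
      ⟨SymbolPair.isCyclicCode_cyclicCode _, ?_⟩,
      ⟨SymbolPair.genPoly_monic ω, SymbolPair.genPoly_dvd_X_pow_sub_one h (by omega), rfl⟩,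
      ⟨SymbolPair.finrank_cyclicCode_genPoly h hp,
        SymbolPair.isMinHammingDist_cyclicCode_genPoly h hp⟩,
      SymbolPair.isMinPairDist_cyclicCode_genPoly h hp,
      SymbolPair.isMDSPairCode_cyclicCode_genPoly h hp⟩
    rw [ZMod.ringChar_zmod_n]
    exact dvd_mul_left p 3
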